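/- Throughout, a map $f:X\to Y$ of topological spaces is *Baire-one* if it is the pointwise limit of a sequence of continuous maps $X\to Y$. A set $U\subseteq X$ is *functionally open* if $U=\{x:\varphi(x)\neq 0\}$ for some continuous $\varphi:X\to\mathbb R$. A function $f:X\to\mathbb R$ is *functionally countably fragmented* if for every $\varepsilon>0$ there are a countable ordinal $\alpha$ and functionally open sets $U_\xi\subseteq X$ $(0\le\xi\le\alpha)$ such that - $U_0=\emptyset$, $U_\alpha=X$, and $U_\xi\subseteq U_\eta$ whenever $\xi\le\eta\le\alpha$; - $U_\gamma=\bigcup_{\xi<\gamma}U_\xi$ for every limit ordinal $\gamma\le\alpha$; - $\operatorname{diam} f(U_{\xi+1}\setminus U_\xi)<\varepsilon$ for every $\xi<\alpha$ (the diameter of an unbounded set being $\infty$ and that of the empty set $0$). **Theorem.** Let $X$ be a completely regular space and let $f:X\to\mathbb R$ be a Baire-one function. Then the following are equivalent: 1. $f$ is functionally countably fragmented; 2. $f$ extends to a Baire-one function on the Stone–Čech compactification $\beta X$, that is, there is a Baire-one function $g:\beta X\to\mathbb R$ with $g(\iota(x))=f(x)$ for all $x\in X$, where $\iota:X\to\beta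 X$ is the canonical map. -/

import Mathlib

open Filter Topology

namespace BaireExt

/-- `f` is Baire-one: a pointwise limit of a sequence of continuous maps. -/
def IsBaireOne {X Y : Type*} [TopologicalSpace X] [TopologicalSpace Y] (f : X → Y) : Prop :=
  ∃ F : ℕ → X → Y, (∀ n, Continuous (F n)) ∧ ∀ x, Tendsto (fun n => F n x) atTop (𝓝 (f x))

/-- Functionally open sets (cozero sets): complements of zero sets of continuous real functions. -/
def IsFunctionallyOpen {X : Type*} [TopologicalSpace X] (U : Set X) : Prop :=
  ∃ φ : X → ℝ, Continuous φ ∧ U = {x | φ x ≠ 0}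

/-- The transfinite sequence `(U ξ : ξ ∈ [0, α])` is regular in `X`: it consists of open sets,
increases from `∅` to `X`, and is continuous at every limit ordinal `γ ≤ α`.
Only the values `U ξ` with `ξ ≤ α` matter. -/
structure IsRegularSeq {X : Type*} [TopologicalSpace X] (α : Ordinal) (U : Ordinal → Set X) :
    Prop where
  isOpen : ∀ ξ ≤ α, IsOpen (U ξ)
  zero : U 0 = ∅
  top : U α = Set.univ
  mono : ∀ ξ η, ξ ≤ η → η ≤ α → U ξ ⊆ U η
  limit : ∀ γ ≤ α, Order.IsSuccLimit γ → U γ = ⋃ ξ < γ, U ξ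

/-- The sequence `(U ξ : ξ ∈ [0, α])` is `ε`-associated with `f`: it is regular and
`diam f(U (ξ + 1) \ U ξ) < ε` for every `ξ < α`. The diameter takes values in `[0, ∞]`, so that
unbounded sets have diameter `∞`. -/
def IsAssociatedSeq {X Y : Type*} [TopologicalSpace X] [MetricSpace Y] (ε : ℝ) (f : X → Y)
    (α : Ordinal) (U : Ordinal → Set X) : Prop :=
  IsRegularSeq α U ∧
    ∀ ξ < α, Metric.ediam (f '' (U (ξ + 1) \ U ξ)) < ENNReal.ofReal ε

/-- `f` is functionally `ε`-countably fragmented: some countable sequence of functionally open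
sets is `ε`-associated with `f`. -/
def IsFunctionallyEpsCountablyFragmented {X Y : Type*} [TopologicalSpace X] [MetricSpace Y]
    (ε : ℝ) (f : X → Y) : Prop :=
  ∃ (α : Ordinal.{0}) (U : Ordinal.{0} → Set X), α.card ≤ Cardinal.aleph0 ∧
    IsAssociatedSeq ε f α U ∧ ∀ ξ ≤ α, IsFunctionallyOpen (U ξ)

/-- `f` is functionally countably fragmented: functionally `ε`-countably fragmented for
every `ε > 0`. -/
def IsFunctionallyCountablyFragmented {X Y : Type*} [TopologicalSpace X] [MetricSpace Y]
    (f : X → Y) : Prop :=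
  ∀ ε : ℝ, 0 < ε → IsFunctionallyEpsCountablyFragmented ε f

end BaireExt

namespace BaireExt

/-! ### Operations on Baire-one maps and functionally open sets -/

/-! From fragmentation to extension: for each `ε = 1 / (j + 1)` extend the functions defining the
cozero sets to `βX`. The first index at which one of them is nonzero has countably many values and
`Fσ` fibres, so, coded in `ℕ`, it is Baire-one (`isBaireOne_natCast`). On `X` it determines `f` up
to `ε`, so `f` is a continuous function on `ℕ → ℝ` of all these indices
(`exists_continuous_factor`); the same formula on `βX` is the extension. Conversely, if `G n → g` on
a compact space, `g` factors through the compact metrizable image of `(G n)`, where it becomes the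
limit of coordinates. Baire category fragments this limit (`exists_isOpen_ediam_lt`), second
countability makes the exhaustion countable (`exists_isRegularSeq`), and the sets are pulled back.
-/

theorem IsFunctionallyOpen.preimage {X Y : Type*} [TopologicalSpace X] [TopologicalSpace Y]
    {U : Set Y} (hU : IsFunctionallyOpen U) {p : X → Y} (hp : Continuous p) :
    IsFunctionallyOpen (p ⁻¹' U) := by
  obtain ⟨φ, hφ, rfl⟩ := hU
  exact ⟨φ ∘ p, hφ.comp hp, rfl⟩

theorem isFunctionallyOpen_of_isOpen {Y : Type*} [MetricSpace Y] {U : Set Y} (hU : IsOpen U) :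
    IsFunctionallyOpen U := by
  rcases Uᶜ.eq_empty_or_nonempty with h | h
  · exact ⟨fun _ => 1, continuous_const, by simp [Set.compl_empty_iff.1 h]⟩
  · refine ⟨fun y => Metric.infDist y Uᶜ, Metric.continuous_infDist_pt _, ?_⟩
    ext y
    have := hU.isClosed_compl.mem_iff_infDist_zero (x := y) h
    simp only [Set.mem_ofPred_eq, ne_eq, ← this, Set.mem_compl_iff, not_not]

/-- A functionally open set is the nonvanishing set of a continuous `[0, 1]`-valued function. -/
theorem IsFunctionallyOpen.exists_unitInterval {X : Type*} [TopologicalSpace X] {U : Set X}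
    (hU : IsFunctionallyOpen U) :
    ∃ φ : X → unitInterval, Continuous φ ∧ U = {x | φ x ≠ 0} := by
  obtain ⟨φ, hφ, rfl⟩ := hU
  refine ⟨fun x => Set.projIcc 0 1 zero_le_one |φ x|, continuous_projIcc.comp hφ.abs, ?_⟩
  ext x
  have : (0 : unitInterval) = ⟨0, Set.left_mem_Icc.2 zero_le_one⟩ := rfl
  simp only [Set.mem_ofPred_eq, ne_eq]
  rw [this, Set.projIcc_eq_left zero_lt_one]
  simp

/-- A function into `ℕ` on a normal space all of whose fibres are `Fσ` sets is Baire-one. -/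
theorem isBaireOne_natCast {Y : Type*} [TopologicalSpace Y] [NormalSpace Y] (T : Y → ℕ)
    (hT : ∀ k, ∃ F : ℕ → Set Y, (∀ m, IsClosed (F m)) ∧ T ⁻¹' {k} = ⋃ m, F m) :
    IsBaireOne (fun y => (T y : ℝ)) := by
  choose F hFc hF using hT
  -- Only finitely many closed pieces at stage `n`, so `T` is continuous on their union and Tietze
  -- applies.
  let C : ℕ → ℕ × ℕ → Set Y := fun n p => if p.1 < n ∧ p.2 < n then F p.1 p.2 else ∅
  have hCc : ∀ n p, IsClosed (C n p) := by
    intro n p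
    simp only [C]
    split_ifs
    exacts [hFc _ _, isClosed_empty]
  have hCT : ∀ n p, ∀ y ∈ C n p, T y = p.1 := by
    intro n p y hy
    simp only [C] at hy
    split_ifs at hy
    · have : y ∈ T ⁻¹' {p.1} := by rw [hF]; exact Set.mem_iUnion.2 ⟨_, hy⟩
      exact this
    · exact hy.elim
  have hfin : ∀ n, LocallyFinite (C n) := by
    intro n y
    refine ⟨Set.univ, Filter.univ_mem, ((Set.finite_Iio n).prod (Set.finite_Iio n)).subset ?_⟩
    rintro p ⟨y, hy, -⟩
    simp only [C] at hy
    split_ifs at hy with h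
    · exact h
    · exact hy.elim
  have key : ∀ n, ∃ h : C(Y, ℝ), ∀ p, ∀ y ∈ C n p, h y = T y := by
    intro n
    have hcont : ContinuousOn (fun y => (T y : ℝ)) (⋃ p, C n p) := by
      refine (hfin n).continuousOn_iUnion (hCc n) fun p => ?_
      exact (continuousOn_const (c := (p.1 : ℝ))).congr fun y hy => by simp [hCT n p y hy]
    obtain ⟨h, hh⟩ := ContinuousMap.exists_restrict_eq ((hfin n).isClosed_iUnion (hCc n))
      ⟨_, hcont.domRestrict⟩
    refine ⟨h, fun p y hy => ?_⟩
    exact congrArg (fun u => u ⟨y, Set.mem_iUnion.2 ⟨p, hy⟩⟩) hh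
  choose h hh using key
  refine ⟨fun n => h n, fun n => (h n).continuous, fun y => ?_⟩
  obtain ⟨m, hm⟩ := Set.mem_iUnion.1 ((hF (T y)).subset (rfl : y ∈ T ⁻¹' {T y}))
  refine tendsto_const_nhds.congr' ?_
  filter_upwards [eventually_gt_atTop (T y), eventually_gt_atTop m] with n h1 h2
  refine (hh n (T y, m) y ?_).symm
  simp only [C]
  rwa [if_pos ⟨h1, h2⟩]

theorem IsBaireOne.comp_pi {Y : Type*} [TopologicalSpace Y] {T : Y → ℕ → ℝ}
    (hT : ∀ j, IsBaireOne fun y => T y j) {F : (ℕ → ℝ) → ℝ} (hF : Continuous F) :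
    IsBaireOne (F ∘ T) := by
  choose h hc hl using hT
  refine ⟨fun n y => F fun j => h j n y,
    fun n => hF.comp (continuous_pi fun j => hc j n), fun y => ?_⟩
  exact (hF.tendsto (T y)).comp (tendsto_pi_nhds.2 fun j => hl j y)

/-- A real function which is determined up to arbitrarily small errors by single coordinates of
a map `T` into `ℕ → ℕ` factors through `T` and a continuous function on `ℕ → ℝ`. -/
theorem exists_continuous_factor {X : Type*} (T : X → ℕ → ℕ) (f : X → ℝ)
    (H : ∀ ε > 0, ∃ j, ∀ x x', T x j = T x' j → dist (f x) (f x') < ε) :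
    ∃ F : (ℕ → ℝ) → ℝ, Continuous F ∧ ∀ x, F (fun j => (T x j : ℝ)) = f x := by
  let T' : X → ℕ → ℝ := fun x j => T x j
  have hfac : f.FactorsThrough T' := by
    intro x x' hx
    refine eq_of_forall_dist_le fun ε hε => ?_
    obtain ⟨j, hj⟩ := H ε hε
    exact (hj x x' (Nat.cast_injective (R := ℝ) (congrFun hx j))).le
  let u : (ℕ → ℝ) → ℝ := Function.extend T' f 0
  have hu : ∀ x, u (T' x) = f x := fun x => hfac.extend_apply 0 x
  let S := Set.range T'
  -- Integers within `1 / 2` of the same real number coincide.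
  have hnear : ∀ z, ∀ ε > 0, ∃ s ∈ 𝓝[S] z, ∀ v ∈ s, ∀ w ∈ s, dist (u v) (u w) < ε := by
    intro z ε hε
    obtain ⟨j, hj⟩ := H ε hε
    refine ⟨S ∩ (fun w : ℕ → ℝ => w j) ⁻¹' Metric.ball (z j) (1 / 2),
      Filter.inter_mem self_mem_nhdsWithin (mem_nhdsWithin_of_mem_nhds
        ((continuous_apply j).continuousAt.preimage_mem_nhds
          (Metric.ball_mem_nhds _ (by norm_num)))), ?_⟩
    rintro _ ⟨⟨x, rfl⟩, hx⟩ _ ⟨⟨x', rfl⟩, hx'⟩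
    rw [hu, hu]
    apply hj
    have h1 : dist (T x j : ℝ) (T x' j) < 1 := by
      have := dist_triangle_right (T x j : ℝ) (T x' j) (z j)
      have h2 : dist (T x j : ℝ) (z j) < 1 / 2 := hx
      have h3 : dist (T x' j : ℝ) (z j) < 1 / 2 := hx'
      linarith
    rw [Nat.dist_cast_real] at h1
    by_contra hne
    exact absurd (Nat.pairwise_one_le_dist hne) (not_le.2 h1)
  have hlim : ∀ z ∈ closure S, ∃ y, Tendsto u (𝓝[S] z) (𝓝 y) := by
    intro z hz
    have : (𝓝[S] z).NeBot := mem_closure_iff_nhdsWithin_neBot.1 hz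
    have hc : Cauchy (map u (𝓝[S] z)) := by
      refine Metric.cauchy_iff.2 ⟨inferInstance, fun ε hε => ?_⟩
      obtain ⟨s, hs, hd⟩ := hnear z ε hε
      refine ⟨u '' s, image_mem_map hs, ?_⟩
      rintro _ ⟨v, hv, rfl⟩ _ ⟨w, hw, rfl⟩
      exact hd v hv w hw
    exact CompleteSpace.complete hc
  have hcont : ContinuousOn (extendFrom S u) (closure S) := continuousOn_extendFrom le_rfl hlim
  obtain ⟨F, hF⟩ := ContinuousMap.exists_restrict_eq isClosed_closure ⟨_, hcont.domRestrict⟩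
  refine ⟨F, F.continuous, fun x => ?_⟩
  have hx : T' x ∈ S := ⟨x, rfl⟩
  have h1 : F (T' x) = extendFrom S u (T' x) :=
    congrArg (fun v => v ⟨T' x, subset_closure hx⟩) hF
  have h2 : extendFrom S u (T' x) = u (T' x) := by
    refine extendFrom_eq (subset_closure hx) (Metric.tendsto_nhds.2 fun ε hε => ?_)
    obtain ⟨s, hs, hd⟩ := hnear (T' x) ε hε
    filter_upwards [hs] with v hv
    exact hd v hv _ (mem_of_mem_nhdsWithin hx hs)
  exact h1.trans (h2.trans (hu x))

/-! ### From countable fragmentation to an extension -/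

theorem countable_Iic_of_card_le {α : Ordinal.{0}} (h : α.card ≤ Cardinal.aleph0) :
    (Set.Iic α).Countable := by
  rw [← Set.Iio_insert]
  refine Set.Countable.insert _ ?_
  rw [← Cardinal.le_aleph0_iff_set_countable, Cardinal.mk_Iio_ordinal]
  exact Cardinal.lift_le_aleph0.2 h

/-- The index at which a point enters a transfinite sequence of cozero sets has `Fσ` fibres. -/
theorem exists_isClosed_iUnion_entry {Y : Type*} [TopologicalSpace Y]
    (φ : Ordinal.{0} → Y → unitInterval) (hφ : ∀ ξ, Continuous (φ ξ))
    (hne : ∀ y, ∃ ξ, φ ξ y ≠ 0) (ξ : Ordinal.{0}) :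
    ∃ F : ℕ → Set Y, (∀ m, IsClosed (F m)) ∧
      {y | sInf {η | φ η y ≠ 0} = ξ} = ⋃ m, F m := by
  refine ⟨fun m => {y | 1 / ((m : ℝ) + 1) ≤ φ ξ y} ∩ ⋂ η : Set.Iio ξ, {y | φ η y = 0},
    fun m => ?_, ?_⟩
  · exact (isClosed_le continuous_const (continuous_subtype_val.comp (hφ ξ))).inter
      (isClosed_iInter fun η => isClosed_eq (hφ η) continuous_const)
  · ext y
    simp only [Set.mem_ofPred_eq, Set.mem_iUnion, Set.mem_inter_iff, Set.mem_iInter]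
    constructor
    · rintro rfl
      have h1 : φ (sInf {η | φ η y ≠ 0}) y ≠ 0 := csInf_mem (s := {η | φ η y ≠ 0}) (hne y)
      obtain ⟨m, hm⟩ := exists_nat_one_div_lt (K := ℝ) (unitInterval.pos_iff_ne_zero.2 h1)
      refine ⟨m, hm.le, fun η => ?_⟩
      by_contra h
      exact notMem_of_lt_csInf' (s := {η | φ η y ≠ 0}) η.2 h
    · rintro ⟨m, hm, h0⟩
      have h1 : φ ξ y ≠ 0 := unitInterval.pos_iff_ne_zero.1 <|
        show (0 : ℝ) < φ ξ y from lt_of_lt_of_le (by positivity : 0 < 1 / ((m : ℝ) + 1)) hm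
      refine le_antisymm (csInf_le' h1) (le_csInf ⟨ξ, h1⟩ fun η hη => ?_)
      by_contra h
      exact hη (h0 ⟨η, not_le.1 h⟩)

/-- The entry index is neither zero nor a limit, so both points lie in the same difference `U (η +
1) \ U η`. -/
theorem IsAssociatedSeq.dist_lt_of_sInf_eq {X Y : Type*} [TopologicalSpace X] [MetricSpace Y]
    {ε : ℝ} {f : X → Y} {α : Ordinal} {U : Ordinal → Set X} (h : IsAssociatedSeq ε f α U)
    {x x' : X} (hx : sInf {ξ | ξ ≤ α ∧ x ∈ U ξ} = sInf {ξ | ξ ≤ α ∧ x' ∈ U ξ}) :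
    dist (f x) (f x') < ε := by
  obtain ⟨hU, hd⟩ := h
  have hmem : ∀ x, sInf {ξ | ξ ≤ α ∧ x ∈ U ξ} ∈ {ξ | ξ ≤ α ∧ x ∈ U ξ} := fun x =>
    csInf_mem ⟨α, le_rfl, by simp [hU.top]⟩
  have hnot : ∀ x, ∀ η < sInf {ξ | ξ ≤ α ∧ x ∈ U ξ}, x ∉ U η := fun x η hη hxη =>
    notMem_of_lt_csInf' hη ⟨hη.le.trans (hmem x).1, hxη⟩
  obtain ⟨hξ, hxξ⟩ := hmem x
  have hx'ξ := (hmem x').2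
  have hn := hnot x
  have hn' := hnot x'
  rw [← hx] at hx'ξ hn'
  generalize sInf {ξ | ξ ≤ α ∧ x ∈ U ξ} = ξ at *
  rcases Ordinal.zero_or_succ_or_isSuccLimit ξ with rfl | ⟨η, rfl⟩ | hl
  · simp [hU.zero] at hxξ
  · have hη : η < η + 1 := Order.lt_add_one_iff.2 le_rfl
    have hmem : x ∈ U (η + 1) \ U η := ⟨hxξ, hn η hη⟩
    have hmem' : x' ∈ U (η + 1) \ U η := ⟨hx'ξ, hn' η hη⟩
    have := (Metric.edist_le_ediam_of_mem (Set.mem_image_of_mem f hmem)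
      (Set.mem_image_of_mem f hmem')).trans_lt (hd η (hη.trans_le hξ))
    rw [edist_dist] at this
    exact (ENNReal.ofReal_lt_ofReal_iff_of_nonneg dist_nonneg).1 this
  · rw [hU.limit ξ hξ hl] at hxξ
    obtain ⟨η, hη, hxη⟩ := Set.mem_iUnion₂.1 hxξ
    exact (hn η hη hxη).elim

theorem exists_natIndex_extension {X : Type*} [TopologicalSpace X] {f : X → ℝ} {ε : ℝ}
    (hf : IsFunctionallyEpsCountablyFragmented ε f) :
    ∃ T : StoneCech X → ℕ, IsBaireOne (fun y => (T y : ℝ)) ∧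
      ∀ x x', T (stoneCechUnit x) = T (stoneCechUnit x') → dist (f x) (f x') < ε := by
  obtain ⟨α, U, hα, hU, ho⟩ := hf
  choose! φ hφ hφU using fun ξ hξ => (ho ξ hξ).exists_unitInterval
  classical
  -- The extended cozero sets need not cover `βX`; the value `1` past `α` makes every remaining
  -- point enter at `α + 1`. Monotonicity on `βX` is not needed.
  let ψ : Ordinal.{0} → StoneCech X → unitInterval := fun ξ =>
    if h : ξ ≤ α then stoneCechExtend (hφ ξ h) else 1
  have hψ : ∀ ξ, Continuous (ψ ξ) := by
    intro ξ
    by_cases h : ξ ≤ α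
    · simpa only [ψ, dif_pos h] using continuous_stoneCechExtend (hφ ξ h)
    · simp only [ψ, dif_neg h]
      exact continuous_const
  have hψα : ∀ y, ψ (α + 1) y ≠ 0 := by
    intro y
    have : ¬ α + 1 ≤ α := not_le.2 (Order.lt_add_one_iff.2 le_rfl)
    simp [ψ, dif_neg this]
  let i : StoneCech X → Ordinal.{0} := fun y => sInf {η | ψ η y ≠ 0}
  have hi : ∀ y, i y ∈ Set.Iic (α + 1) := fun y =>
    csInf_le' (s := {η | ψ η y ≠ 0}) (hψα y)
  have hcount : (Set.Iic (α + 1)).Countable := by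
    rw [← Order.succ_eq_add_one, Order.Iic_succ]
    exact (countable_Iic_of_card_le hα).insert _
  obtain ⟨e, he⟩ := Set.countable_iff_exists_injOn.1 hcount
  refine ⟨e ∘ i, isBaireOne_natCast _ fun k => ?_, fun x x' h => ?_⟩
  · by_cases hk : ∃ ξ ∈ Set.Iic (α + 1), e ξ = k
    · obtain ⟨ξ, hξ, rfl⟩ := hk
      obtain ⟨F, hF, hF'⟩ := exists_isClosed_iUnion_entry ψ hψ (fun y => ⟨_, hψα y⟩) ξ
      refine ⟨F, hF, hF' ▸ ?_⟩
      ext y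
      exact he.eq_iff (hi y) hξ
    · refine ⟨fun _ => ∅, fun _ => isClosed_empty, ?_⟩
      rw [Set.iUnion_empty, Set.eq_empty_iff_forall_notMem]
      exact fun y hy => hk ⟨_, hi y, hy⟩
  · have hix : ∀ x, i (stoneCechUnit x) = sInf {ξ | ξ ≤ α ∧ x ∈ U ξ} := by
      intro x
      have hmem : ∀ ξ ≤ α, (ψ ξ (stoneCechUnit x) ≠ 0 ↔ x ∈ U ξ) := by
        intro ξ hξ
        rw [hφU ξ hξ]
        simp [ψ, dif_pos hξ]
      have htop : α ∈ {ξ | ξ ≤ α ∧ x ∈ U ξ} := ⟨le_rfl, by simp [hU.1.top]⟩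
      refine le_antisymm (csInf_le' ?_) (le_csInf ⟨_, hψα _⟩ fun η hη => ?_)
      · have := csInf_mem ⟨α, htop⟩
        exact (hmem _ this.1).2 this.2
      · rcases le_or_gt η α with h | h
        · exact csInf_le' ⟨h, (hmem η h).1 hη⟩
        · exact (csInf_le' htop).trans h.le
    exact hU.dist_lt_of_sInf_eq (by rw [← hix, ← hix]; exact he (hi _) (hi _) h)

theorem IsFunctionallyCountablyFragmented.exists_extension {X : Type*} [TopologicalSpace X]
    {f : X → ℝ} (hf : IsFunctionallyCountablyFragmented f) :
    ∃ g : StoneCech X → ℝ, IsBaireOne g ∧ ∀ x : X, g (stoneCechUnit x) = f x := by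
  choose T hT hTf using fun j : ℕ => exists_natIndex_extension (hf (1 / (j + 1)) (by positivity))
  obtain ⟨F, hF, hFf⟩ := exists_continuous_factor (fun x j => T j (stoneCechUnit x)) f (by
    intro ε hε
    obtain ⟨j, hj⟩ := exists_nat_one_div_lt hε
    exact ⟨j, fun x x' h => (hTf j x x' h).trans hj⟩)
  exact ⟨F ∘ fun y j => (T j y : ℝ), IsBaireOne.comp_pi hT hF, hFf⟩

/-! ### Exhausting a second countable space by a countable transfinite sequence -/

/-- The transfinite iteration of `N`, starting from the empty set. -/
noncomputable def iterateUnion {Y : Type*} (N : Set Y → Set Y) (ξ : Ordinal.{0}) : Set Y :=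
  ⋃ η : Set.Iio ξ, N (iterateUnion N η)
termination_by ξ
decreasing_by exact η.2

/-- Each proper step captures a new basic open set, so never reaching the whole space would inject
`ω₁` into a countable basis. -/
theorem exists_isRegularSeq {Y : Type*} [TopologicalSpace Y] [SecondCountableTopology Y]
    (P : Set Y → Prop) (hP : ∀ U, IsOpen U → U ≠ Set.univ → ∃ V, IsOpen V ∧ U ⊂ V ∧ P (V \ U))
    (hP0 : P ∅) :
    ∃ (α : Ordinal.{0}) (U : Ordinal.{0} → Set Y), α.card ≤ Cardinal.aleph0 ∧
      IsRegularSeq α U ∧ ∀ ξ < α, P (U (ξ + 1) \ U ξ) := by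
  have hN : ∀ U, ∃ V, U ⊆ V ∧
      (IsOpen U → IsOpen V ∧ P (V \ U) ∧ (U ≠ Set.univ → (V \ U).Nonempty)) := by
    intro U
    by_cases h : IsOpen U ∧ U ≠ Set.univ
    · obtain ⟨V, hV, hUV, hPV⟩ := hP U h.1 h.2
      exact ⟨V, hUV.subset, fun _ => ⟨hV, hPV, fun _ => Set.nonempty_of_ssubset hUV⟩⟩
    · refine ⟨U, subset_rfl, fun hU => ⟨hU, by simpa using hP0, fun hne => (h ⟨hU, hne⟩).elim⟩⟩
  choose N hsub hN using hN
  let U := iterateUnion N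
  have hUdef : ∀ ξ, U ξ = ⋃ η : Set.Iio ξ, N (U η) := fun ξ => by
    simp only [U]
    rw [iterateUnion]
  have hopen : ∀ ξ, IsOpen (U ξ) := by
    intro ξ
    induction ξ using WellFoundedLT.induction with
    | ind ξ ih =>
      rw [hUdef]
      exact isOpen_iUnion fun η => (hN _ (ih η η.2)).1
  have hle : ∀ {η ξ}, η < ξ → N (U η) ⊆ U ξ := fun {η ξ} h => by
    rw [hUdef ξ]
    exact Set.subset_iUnion (fun η : Set.Iio ξ => N (U η)) ⟨η, h⟩
  have hmono : ∀ ξ η, ξ ≤ η → U ξ ⊆ U η := by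
    intro ξ η h
    rw [hUdef ξ]
    exact Set.iUnion_subset fun ζ => hle (ζ.2.trans_le h)
  have hlt : ∀ ξ : Ordinal.{0}, ξ < ξ + 1 := fun ξ => Order.lt_add_one_iff.2 le_rfl
  have hsucc : ∀ ξ, U (ξ + 1) = N (U ξ) := by
    intro ξ
    refine Set.Subset.antisymm ?_ (hle (hlt ξ))
    rw [hUdef]
    refine Set.iUnion_subset fun η => ?_
    rcases (Order.lt_add_one_iff.1 (Set.mem_Iio.1 η.2)).lt_or_eq with h | h
    · exact (hle h).trans (hsub _)
    · rw [h]
  have htop : ∃ α < (Cardinal.aleph 1).ord, U α = Set.univ := by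
    by_contra! hne
    have hpt : ∀ ξ : Set.Iio (Cardinal.aleph.{0} 1).ord,
        ∃ b ∈ TopologicalSpace.countableBasis Y, b ⊆ U (ξ + 1) ∧ ¬ b ⊆ U ξ := by
      intro ξ
      obtain ⟨y, hy, hy'⟩ := (hN _ (hopen ξ)).2.2 (hne ξ ξ.2)
      rw [← hsucc] at hy
      obtain ⟨b, hb, hyb, hbU⟩ :=
        (TopologicalSpace.isBasis_countableBasis Y).exists_subset_of_mem_open hy (hopen _)
      exact ⟨b, hb, hbU, fun h => hy' (h hyb)⟩
    choose b hb hbU hbU' using hpt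
    have hinj : Function.Injective
        (fun ξ => (⟨b ξ, hb ξ⟩ : TopologicalSpace.countableBasis Y)) := by
      intro ξ η h
      have h : b ξ = b η := congrArg Subtype.val h
      by_contra hne
      rcases lt_or_gt_of_ne hne with hlt | hlt
      · exact hbU' η (h ▸ (hbU ξ).trans (hmono _ _ (Order.add_one_le_of_lt hlt)))
      · exact hbU' ξ (h ▸ (hbU η).trans (hmono _ _ (Order.add_one_le_of_lt hlt)))
    have : Countable (TopologicalSpace.countableBasis Y) :=
      (TopologicalSpace.countable_countableBasis Y).to_subtype
    have hc := Cardinal.le_aleph0_iff_set_countable.2 (Set.countable_coe_iff.1 hinj.countable)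
    rw [Cardinal.mk_Iio_ordinal, Cardinal.card_ord, Cardinal.lift_le_aleph0] at hc
    exact absurd Cardinal.aleph0_lt_aleph_one (not_lt.2 hc)
  obtain ⟨α, hα, hαU⟩ := htop
  refine ⟨α, U, ?_, ⟨fun ξ _ => hopen ξ, ?_, hαU, fun ξ η h _ => hmono ξ η h, ?_⟩, ?_⟩
  · rw [Cardinal.lt_ord, ← Cardinal.succ_aleph0] at hα
    exact Order.lt_succ_iff.1 hα
  · rw [hUdef]
    simp
  · intro γ _ hγ
    refine Set.Subset.antisymm ?_ (Set.iUnion₂_subset fun ξ hξ => hmono _ _ hξ.le)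
    rw [hUdef γ]
    refine Set.iUnion_subset fun η => ?_
    rw [← hsucc]
    exact Set.subset_iUnion₂ (s := fun ξ (_ : ξ < γ) => U ξ) (η.1 + 1) (hγ.add_one_lt η.2)
  · intro ξ _
    rw [hsucc]
    exact (hN _ (hopen ξ)).2.1

/-! ### Limits of coordinates on a compact set of sequences -/

/-- On a compact set of convergent sequences the limit is fragmented. -/
theorem exists_isOpen_ediam_lt {Z : Set (ℕ → ℝ)} (hZ : IsCompact Z) (h : Z → ℝ)
    (hh : ∀ z : Z, Tendsto z.1 atTop (𝓝 (h z))) {ε : ℝ} (hε : 0 < ε) (U : Set Z)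
    (hU : IsOpen U) (hne : U ≠ Set.univ) :
    ∃ V, IsOpen V ∧ U ⊂ V ∧ Metric.ediam (h '' (V \ U)) < ENNReal.ofReal ε := by
  have : CompactSpace Z := isCompact_iff_compactSpace.1 hZ
  have : CompactSpace (Uᶜ : Set Z) :=
    isCompact_iff_compactSpace.1 hU.isClosed_compl.isCompact
  have : Nonempty (Uᶜ : Set Z) := (Set.nonempty_compl.2 hne).to_subtype
  have hcoord : ∀ n, Continuous fun z : (Uᶜ : Set Z) => z.1.1 n := fun n =>
    (continuous_apply n).comp (continuous_subtype_val.comp continuous_subtype_val)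
  -- Pointwise convergence makes these closed sets cover the compact set `Uᶜ`, so one has interior.
  let C : ℕ → Set (Uᶜ : Set Z) := fun N => ⋂ n ≥ N, {z | dist (z.1.1 n) (z.1.1 N) ≤ ε / 8}
  obtain ⟨N, z₀, hz₀⟩ := nonempty_interior_of_iUnion_of_closed (f := C)
    (fun N => isClosed_biInter fun n _ =>
      isClosed_le ((hcoord n).dist (hcoord N)) continuous_const) (by
    refine Set.eq_univ_of_forall fun z => ?_
    obtain ⟨N, hN⟩ := Metric.cauchySeq_iff'.1 (hh z.1).cauchySeq (ε / 8) (by positivity)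
    exact Set.mem_iUnion.2 ⟨N, Set.mem_iInter₂.2 fun n hn => (hN n hn).le⟩)
  obtain ⟨V, hV, hVW⟩ := isOpen_induced_iff.1
    (isOpen_interior.inter (Metric.isOpen_ball.preimage (hcoord N)) :
      IsOpen (interior (C N) ∩
        (fun z : (Uᶜ : Set Z) => z.1.1 N) ⁻¹' Metric.ball (z₀.1.1 N) (ε / 8)))
  have hz₀V : z₀.1 ∈ V := by
    have : z₀ ∈ Subtype.val ⁻¹' V := by
      rw [hVW]
      exact ⟨hz₀, Metric.mem_ball_self (by positivity)⟩
    exact this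
  refine ⟨U ∪ V, hU.union hV, Set.ssubset_iff_exists.2
    ⟨Set.subset_union_left, z₀.1, Or.inr hz₀V, z₀.2⟩, ?_⟩
  have hclose : ∀ z ∈ (U ∪ V) \ U, dist (h z) (z₀.1.1 N) ≤ ε / 4 := by
    rintro z ⟨hzV, hzU⟩
    have hz : (⟨z, hzU⟩ : (Uᶜ : Set Z)) ∈ Subtype.val ⁻¹' V := hzV.resolve_left hzU
    rw [hVW] at hz
    have h1 : dist (h z) (z.1 N) ≤ ε / 8 := by
      refine le_of_tendsto ((hh z).dist tendsto_const_nhds) ?_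
      filter_upwards [eventually_ge_atTop N] with n hn
      exact Set.mem_iInter₂.1 (interior_subset hz.1) n hn
    have h2 : dist (z.1 N) (z₀.1.1 N) < ε / 8 := hz.2
    linarith [dist_triangle (h z) (z.1 N) (z₀.1.1 N)]
  refine (Metric.ediam_le (d := ENNReal.ofReal (ε / 2)) ?_).trans_lt
    ((ENNReal.ofReal_lt_ofReal_iff hε).2 (by linarith))
  rintro _ ⟨z, hz, rfl⟩ _ ⟨w, hw, rfl⟩
  rw [edist_dist]
  refine ENNReal.ofReal_le_ofReal ?_
  linarith [dist_triangle_right (h z) (h w) (z₀.1.1 N), hclose z hz, hclose w hw]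

/-! ### Pulling fragmentation back along continuous maps -/

theorem IsRegularSeq.preimage {X Y : Type*} [TopologicalSpace X] [TopologicalSpace Y]
    {α : Ordinal} {U : Ordinal → Set Y} (hU : IsRegularSeq α U) {p : X → Y}
    (hp : Continuous p) : IsRegularSeq α fun ξ => p ⁻¹' U ξ where
  isOpen ξ hξ := (hU.isOpen ξ hξ).preimage hp
  zero := by simp [hU.zero]
  top := by simp [hU.top]
  mono ξ η h h' := Set.preimage_mono (hU.mono ξ η h h')
  limit γ hγ hl := by simp [hU.limit γ hγ hl]

theorem IsFunctionallyCountablyFragmented.comp {X Y E : Type*} [TopologicalSpace X]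
    [TopologicalSpace Y] [MetricSpace E] {f : Y → E} (hf : IsFunctionallyCountablyFragmented f)
    {p : X → Y} (hp : Continuous p) : IsFunctionallyCountablyFragmented (f ∘ p) := by
  intro ε hε
  obtain ⟨α, U, hα, ⟨hU, hd⟩, ho⟩ := hf ε hε
  refine ⟨α, fun ξ => p ⁻¹' U ξ, hα, ⟨hU.preimage hp, fun ξ hξ => ?_⟩,
    fun ξ hξ => (ho ξ hξ).preimage hp⟩
  refine (Metric.ediam_mono ?_).trans_lt (hd ξ hξ)
  rw [Set.image_comp]
  exact Set.image_mono (Set.image_preimage_subset p (U (ξ + 1) \ U ξ))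

theorem IsBaireOne.isFunctionallyCountablyFragmented {K : Type*} [TopologicalSpace K]
    [CompactSpace K] {g : K → ℝ} (hg : IsBaireOne g) : IsFunctionallyCountablyFragmented g := by
  obtain ⟨G, hG, hlim⟩ := hg
  let p : K → ℕ → ℝ := fun y n => G n y
  have hp : Continuous p := continuous_pi hG
  have hconv : ∀ z : Set.range p, ∃ l, Tendsto z.1 atTop (𝓝 l) := by
    rintro ⟨_, y, rfl⟩
    exact ⟨g y, hlim y⟩
  choose h hh using hconv
  have hgh : g = h ∘ Set.rangeFactorization p :=
    funext fun y => tendsto_nhds_unique (hlim y) (hh (Set.rangeFactorization p y))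
  rw [hgh]
  refine IsFunctionallyCountablyFragmented.comp (fun ε hε => ?_) (hp.subtype_mk _)
  obtain ⟨α, U, hα, hU, hd⟩ := exists_isRegularSeq
    (fun S => Metric.ediam (h '' S) < ENNReal.ofReal ε)
    (fun U => exists_isOpen_ediam_lt (isCompact_range hp) h hh hε U) (by simpa using hε)
  let _ : MetricSpace (Set.range p) := TopologicalSpace.metrizableSpaceMetric _
  exact ⟨α, U, hα, ⟨hU, hd⟩, fun ξ hξ => isFunctionallyOpen_of_isOpen (hU.isOpen ξ hξ)⟩

end BaireExt

theorem mainTheorem1 {X : Type*} [TopologicalSpace X] [CompletelyRegularSpace X]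
    (f : X → ℝ) (hf : BaireExt.IsBaireOne f) :
    BaireExt.IsFunctionallyCountablyFragmented f ↔
      ∃ g : StoneCech X → ℝ, BaireExt.IsBaireOne g ∧ ∀ x : X, g (stoneCechUnit x) = f x := by
  refine ⟨fun h => h.exists_extension, ?_⟩
  rintro ⟨g, hg, hgf⟩
  have : f = g ∘ stoneCechUnit := funext fun x => (hgf x).symm
  rw [this]
  exact hg.isFunctionallyCountablyFragmented.comp continuous_stoneCechUnit
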